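/- Let $I=(a,b)$ with $a<b$ real. For $u\in L^1(I)$ put $J(u)=\sup\{\int_I u\,\xi'\,dx : \xi\in C_0^1(I),\ \|\xi\|_\infty\le 1\}$, where $C_0^1(I)$ denotes the continuously differentiable functions with compact support in $I$, and let $BV(I)=\{u\in L^1(I): J(u)<\infty\}$. For $\lambda>0$ and $f\in L^2(I)$ let $E_\lambda(u)=\lambda J(u)+\tfrac12\|f-u\|_{L^2(I)}^2$ for $u\in BV(I)$. Suppose $f\in BV(I)$. Then for every $\lambda>0$ the functional $E_\lambda$ has a minimizer $u_\lambda$ over $BV(I)$, unique up to equality almost everywhere; the distributional derivatives $f'$ and $u_\lambda'$ are finite signed measures on $I$, and, as measures on $I$, $$-(f')^-\le u_\lambda'\le (f')^+,$$ where $(f')^+$ and $(f')^-$ are the positive and negative variations (Jordan decomposition) of $f'$. -/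

import Mathlib

open MeasureTheory Set
open scoped ENNReal

namespace ROF

/-- The test functions `C_0^1(I)` on `I = (a, b)`: continuously differentiable with compact
support contained in `I` (identified with their extension by zero to the real line). -/
structure IsTest (a b : ℝ) (ξ : ℝ → ℝ) : Prop where
  contDiff : ContDiff ℝ 1 ξ
  hasCompactSupport : HasCompactSupport ξ
  tsupport_subset : tsupport ξ ⊆ Ioo a b

/-- The total variation `J(u) = sup { ∫_I u ξ' : ξ ∈ C_0^1(I), ‖ξ‖_∞ ≤ 1 }`, with values in
`[0, ∞]`. (Since `ξ = 0` is admissible the supremum is nonnegative, so truncating the competing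
integrals at `0` with `ENNReal.ofReal` does not change it.) It is only used for `u ∈ L^1(I)`. -/
noncomputable def totalVariation (a b : ℝ) (u : ℝ → ℝ) : ℝ≥0∞ :=
  ⨆ (ξ : ℝ → ℝ) (_ : IsTest a b ξ) (_ : ∀ x, |ξ x| ≤ 1),
    ENNReal.ofReal (∫ x in Ioo a b, u x * deriv ξ x)

/-- `u ∈ BV(I)`, `I = (a, b)`: `u ∈ L^1(I)` and `J(u) < ∞`. Only the values of `u` on `I`
matter. -/
def MemBV (a b : ℝ) (u : ℝ → ℝ) : Prop :=
  IntegrableOn u (Ioo a b) ∧ totalVariation a b u < ∞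

/-- The Rudin-Osher-Fatemi energy `E_λ(f; u) = λ J(u) + ½ ‖f - u‖²_{L²(I)}`, as an element of
`[0, ∞]`. -/
noncomputable def energy (a b lam : ℝ) (f u : ℝ → ℝ) : ℝ≥0∞ :=
  ENNReal.ofReal lam * totalVariation a b u + 2⁻¹ * ∫⁻ x in Ioo a b, ‖f x - u x‖ₑ ^ 2

/-- `u` minimizes `E_λ(f; ·)` over `BV(I)`. -/
def IsMinimizer (a b lam : ℝ) (f u : ℝ → ℝ) : Prop :=
  MemBV a b u ∧ ∀ v : ℝ → ℝ, MemBV a b v → energy a b lam f u ≤ energy a b lam f v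

/-- The positive variation `μ⁺` of a finite signed measure, again as a signed measure. -/
noncomputable def posVar {α : Type*} [MeasurableSpace α] (μ : SignedMeasure α) :
    SignedMeasure α :=
  μ.toJordanDecomposition.posPart.toSignedMeasure

/-- The negative variation `μ⁻` of a finite signed measure, again as a signed measure. -/
noncomputable def negVar {α : Type*} [MeasurableSpace α] (μ : SignedMeasure α) :
    SignedMeasure α :=
  μ.toJordanDecomposition.negPart.toSignedMeasure

/-- The distributional derivative of `u` on `I = (a, b)` is the finite signed measure `μ` on `I`:
`∫_I u ξ' dx = - ∫_I ξ dμ` for all `ξ ∈ C_0^1(I)`, where `∫ ξ dμ = ∫ ξ dμ⁺ - ∫ ξ dμ⁻`.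
Such a `μ` is unique. -/
def HasDistribDeriv (a b : ℝ) (u : ℝ → ℝ) (μ : SignedMeasure (Ioo a b)) : Prop :=
  ∀ ξ : ℝ → ℝ, IsTest a b ξ →
    ∫ x in Ioo a b, u x * deriv ξ x =
      -((∫ x : Ioo a b, ξ x ∂μ.toJordanDecomposition.posPart) -
        ∫ x : Ioo a b, ξ x ∂μ.toJordanDecomposition.negPart)

end ROF

namespace ROF

open Filter Topology

/-! The energy is handled by convex duality. Let K be the `L²` closure of the derivatives of test
functions bounded by λ, so that λJ is the support function of K. Let p be the projection of f onto K
and put u = f - p (`exists_projection`). The variational inequality says that p attains the support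
function at u, and this makes u the unique minimizer (`isMinimizer_of_dual`).

The primitive z of p satisfies |z| ≤ λ. Where z > -λ, the dual variable can still be pushed down, so
u is nonincreasing there; where z < λ, u is nondecreasing (`le_of_lt_primitive`,
`ge_of_primitive_lt`).

Write f = c + P - N, with P and N the distribution functions of the Jordan parts of f'
(`MemBV.exists_signedMeasure`). With v = P - u + c one has z' = v - N. Off the contact set {z = -λ},
v is nondecreasing because u is nonincreasing; at contact points where z is differentiable, z is
minimal, so v = N, which is again monotone. `monotoneOn_of_obstacle` glues these facts, so v is
monotone, i.e. (f')⁺ - u' ≥ 0. The mirrored argument for -z shows that u + N is monotone, i.e. u' +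
(f')⁻ ≥ 0. -/

/-! ### Smoothed steps, plateaus and mollification. -/

/-- Bump functions at the origin with radii tending to zero. -/
noncomputable def bump (n : ℕ) : ContDiffBump (0 : ℝ) where
  rIn := 1 / ((n : ℝ) + 1) / 2
  rOut := 1 / ((n : ℝ) + 1)
  rIn_pos := by positivity
  rIn_lt_rOut := by
    have : 0 < 1 / ((n : ℝ) + 1) := by positivity
    linarith

/-- A `C^1` approximation of the Heaviside function. -/
noncomputable def smoothStep (n : ℕ) (t : ℝ) : ℝ :=
  ∫ s in (-(1 / ((n : ℝ) + 1)))..t, (bump n).normed volume s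

theorem hasDerivAt_smoothStep (n : ℕ) (t : ℝ) :
    HasDerivAt (smoothStep n) ((bump n).normed volume t) t :=
  intervalIntegral.integral_hasDerivAt_right
    ((bump n).continuous_normed.intervalIntegrable _ _)
    ((bump n).continuous_normed.stronglyMeasurableAtFilter _ _)
    (bump n).continuous_normed.continuousAt

theorem deriv_smoothStep (n : ℕ) : deriv (smoothStep n) = (bump n).normed volume :=
  funext fun t => (hasDerivAt_smoothStep n t).deriv

theorem contDiff_smoothStep (n : ℕ) : ContDiff ℝ 1 (smoothStep n) := by
  rw [contDiff_one_iff_deriv, deriv_smoothStep]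
  exact ⟨fun t => (hasDerivAt_smoothStep n t).differentiableAt, (bump n).continuous_normed⟩

theorem monotone_smoothStep (n : ℕ) : Monotone (smoothStep n) :=
  monotone_of_deriv_nonneg (fun t => (hasDerivAt_smoothStep n t).differentiableAt) fun t => by
    rw [deriv_smoothStep]; exact (bump n).nonneg_normed t

theorem bump_normed_eq_zero {n : ℕ} {t : ℝ} (h : 1 / ((n : ℝ) + 1) ≤ |t|) :
    (bump n).normed volume t = 0 := by
  rw [← Function.notMem_support, (bump n).support_normed_eq]
  simpa [bump, Real.dist_eq] using h

theorem smoothStep_of_le {n : ℕ} {t : ℝ} (h : t ≤ -(1 / ((n : ℝ) + 1))) : smoothStep n t = 0 := by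
  unfold smoothStep
  rw [intervalIntegral.integral_congr (g := fun _ => 0), intervalIntegral.integral_zero]
  intro s hs
  rw [uIcc_of_ge h] at hs
  exact bump_normed_eq_zero ((le_neg_of_le_neg hs.2).trans (neg_le_abs s))

theorem smoothStep_of_ge {n : ℕ} {t : ℝ} (h : 1 / ((n : ℝ) + 1) ≤ t) : smoothStep n t = 1 := by
  have h0 : 0 < 1 / ((n : ℝ) + 1) := by positivity
  unfold smoothStep
  refine Eq.trans ?_ ((bump n).integral_normed (μ := volume))
  rw [intervalIntegral.integral_of_le (by linarith), ← integral_Icc_eq_integral_Ioc]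
  refine setIntegral_eq_integral_of_forall_compl_eq_zero fun s hs => bump_normed_eq_zero ?_
  by_contra! h'
  rw [abs_lt] at h'
  exact hs ⟨h'.1.le, h'.2.le.trans h⟩

theorem smoothStep_mem_Icc (n : ℕ) (t : ℝ) : smoothStep n t ∈ Icc (0 : ℝ) 1 := by
  constructor
  · rw [← smoothStep_of_le (n := n) (min_le_right t _)]
    exact monotone_smoothStep n (min_le_left _ _)
  · rw [← smoothStep_of_ge (n := n) (le_max_right t _)]
    exact monotone_smoothStep n (le_max_left _ _)

theorem tendsto_one_div_add_one : Tendsto (fun n : ℕ => 1 / ((n : ℝ) + 1)) atTop (𝓝 0) :=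
  tendsto_one_div_add_atTop_nhds_zero_nat

/-- Mollification converges almost everywhere. -/
theorem ae_tendsto_integral_mul_bump {g : ℝ → ℝ} (hg : Integrable g) :
    ∀ᵐ x, Tendsto (fun n => ∫ t, g t * (bump n).normed volume (t - x)) atTop (𝓝 (g x)) := by
  have := ContDiffBump.ae_convolution_tendsto_right_of_locallyIntegrable (φ := bump)
    (l := atTop) (K := 2) (μ := volume) (g := g) tendsto_one_div_add_one
    (Eventually.of_forall fun n => by simp only [bump]; linarith) hg.locallyIntegrable
  filter_upwards [this] with x hx
  refine hx.congr fun n => ?_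
  rw [convolution_eq_swap]
  refine integral_congr_ae (Eventually.of_forall fun t => ?_)
  simp only [ContinuousLinearMap.lsmul_apply, smul_eq_mul]
  rw [mul_comm, ← (bump n).normed_neg, neg_sub]

/-- The difference of two steps: a smooth approximation of the indicator of `[x, y]`. -/
noncomputable def plateau (n : ℕ) (x y t : ℝ) : ℝ := smoothStep n (t - x) - smoothStep n (t - y)

theorem hasDerivAt_plateau (n : ℕ) (x y t : ℝ) :
    HasDerivAt (plateau n x y)
      ((bump n).normed volume (t - x) - (bump n).normed volume (t - y)) t :=
  ((hasDerivAt_smoothStep n (t - x)).comp_sub_const t x).sub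
    ((hasDerivAt_smoothStep n (t - y)).comp_sub_const t y)

theorem contDiff_plateau (n : ℕ) (x y : ℝ) : ContDiff ℝ 1 (plateau n x y) :=
  ((contDiff_smoothStep n).comp (contDiff_id.sub contDiff_const)).sub
    ((contDiff_smoothStep n).comp (contDiff_id.sub contDiff_const))

theorem plateau_nonneg {n : ℕ} {x y : ℝ} (h : x ≤ y) (t : ℝ) : 0 ≤ plateau n x y t :=
  sub_nonneg.2 (monotone_smoothStep n (by linarith))

theorem plateau_eq_zero {n : ℕ} {x y t : ℝ} (h : x ≤ y)
    (ht : t ∉ Icc (x - 1 / ((n : ℝ) + 1)) (y + 1 / ((n : ℝ) + 1))) : plateau n x y t = 0 := by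
  unfold plateau
  rcases lt_or_ge t (x - 1 / ((n : ℝ) + 1)) with h1 | h1
  · rw [smoothStep_of_le (by linarith), smoothStep_of_le (by linarith), sub_zero]
  · have h2 : y + 1 / ((n : ℝ) + 1) < t := by
      by_contra! h2
      exact ht ⟨h1, h2⟩
    rw [smoothStep_of_ge (by linarith), smoothStep_of_ge (by linarith), sub_self]

theorem tsupport_plateau_subset {n : ℕ} {x y : ℝ} (h : x ≤ y) :
    tsupport (plateau n x y) ⊆ Icc (x - 1 / ((n : ℝ) + 1)) (y + 1 / ((n : ℝ) + 1)) :=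
  closure_minimal (fun t ht => by
    by_contra h'
    exact ht (plateau_eq_zero h h')) isClosed_Icc

theorem isTest_of_tsupport_subset_Icc {a b c d : ℝ} {ξ : ℝ → ℝ} (h : ContDiff ℝ 1 ξ)
    (hs : tsupport ξ ⊆ Icc c d) (hc : a < c) (hd : d < b) : IsTest a b ξ :=
  ⟨h, isCompact_Icc.of_isClosed_subset (isClosed_tsupport _) hs,
    hs.trans (Icc_subset_Ioo hc hd)⟩

/-- The points of `(a, b)` where the mollifications of `u` converge to `u`. -/
def mollifyPoints (a b : ℝ) (u : ℝ → ℝ) : Set ℝ :=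
  {x | x ∈ Ioo a b ∧ Tendsto (fun n => ∫ t in Ioo a b, u t * (bump n).normed volume (t - x)) atTop
    (𝓝 (u x))}

theorem ae_mem_mollifyPoints {a b : ℝ} {u : ℝ → ℝ} (hu : IntegrableOn u (Ioo a b)) :
    ∀ᵐ x ∂volume.restrict (Ioo a b), x ∈ mollifyPoints a b u := by
  rw [ae_restrict_iff' measurableSet_Ioo]
  filter_upwards [ae_tendsto_integral_mul_bump (hu.integrable_indicator measurableSet_Ioo)]
    with x hx hxI
  refine ⟨hxI, ?_⟩
  rw [indicator_of_mem hxI] at hx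
  refine hx.congr fun n => ?_
  rw [← integral_indicator measurableSet_Ioo]
  congr 1 with t
  by_cases ht : t ∈ Ioo a b <;> simp [ht]

theorem integrable_mul_bump {a b : ℝ} {u : ℝ → ℝ} (hu : IntegrableOn u (Ioo a b)) (n : ℕ) (x : ℝ) :
    IntegrableOn (fun t => u t * (bump n).normed volume (t - x)) (Ioo a b) := by
  obtain ⟨C, hC⟩ := (bump n).hasCompactSupport_normed (μ := volume).exists_bound_of_continuous
    (bump n).continuous_normed
  exact hu.mul_bdd (c := C) ((bump n).continuous_normed.comp
    (continuous_id.sub continuous_const)).aestronglyMeasurable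
    (Eventually.of_forall fun t => hC _)

/-- The derivative of a plateau is a bump at `x` minus a bump at `y`. This is the bridge from
inequalities tested against `C¹` functions to inequalities between values of `u` at points of a set
of full measure. -/
theorem tendsto_integral_mul_deriv_plateau {a b : ℝ} {u : ℝ → ℝ} (hu : IntegrableOn u (Ioo a b))
    {x y : ℝ} (hx : x ∈ mollifyPoints a b u) (hy : y ∈ mollifyPoints a b u) :
    Tendsto (fun n => ∫ t in Ioo a b, u t * deriv (plateau n x y) t) atTop (𝓝 (u x - u y)) := by
  refine (hx.2.sub hy.2).congr fun n => ?_
  rw [← integral_sub (integrable_mul_bump hu n x) (integrable_mul_bump hu n y)]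
  congr 1 with t
  rw [(hasDerivAt_plateau n x y t).deriv]
  ring

/-! ### Distribution functions of finite measures on the interval. -/

/-- The distribution function of a measure on `(a, b)`. -/
noncomputable def distribFun {a b : ℝ} (ν : Measure (Ioo a b)) (x : ℝ) : ℝ :=
  ν.real {t | (t : ℝ) ≤ x}

theorem measurableSet_coe_le {a b : ℝ} (x : ℝ) : MeasurableSet {t : Ioo a b | (t : ℝ) ≤ x} :=
  measurableSet_le measurable_subtype_coe measurable_const

theorem monotone_distribFun {a b : ℝ} (ν : Measure (Ioo a b)) [IsFiniteMeasure ν] :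
    Monotone (distribFun ν) := fun _ _ hxy =>
  measureReal_mono fun _ ht => le_trans ht hxy

theorem abs_distribFun_le {a b : ℝ} (ν : Measure (Ioo a b)) [IsFiniteMeasure ν] (x : ℝ) :
    |distribFun ν x| ≤ ν.real univ := by
  rw [distribFun, abs_of_nonneg measureReal_nonneg]
  exact measureReal_mono (subset_univ _)

theorem distribFun_add {a b : ℝ} (μ ν : Measure (Ioo a b)) [IsFiniteMeasure μ] [IsFiniteMeasure ν]
    (x : ℝ) : distribFun (μ + ν) x = distribFun μ x + distribFun ν x :=
  measureReal_add_apply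

theorem exists_mem_Ioo_of_ae {a b : ℝ} {p : ℝ → Prop} (h : ∀ᵐ x ∂volume.restrict (Ioo a b), p x)
    {x y : ℝ} (hx : a ≤ x) (hxy : x < y) (hy : y ≤ b) : ∃ s ∈ Ioo x y, p s := by
  by_contra! hcon
  have h1 : ∀ᵐ s ∂volume.restrict (Ioo x y), p s :=
    ae_restrict_of_ae_restrict_of_subset (Ioo_subset_Ioo hx hy) h
  have h2 : ∀ᵐ s ∂volume.restrict (Ioo x y), False := by
    filter_upwards [h1, ae_restrict_mem measurableSet_Ioo] with s hs hs' using hcon s hs' hs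
  rw [eventually_false_iff_eq_bot, ae_eq_bot, Measure.restrict_eq_zero, Real.volume_Ioo] at h2
  simp only [ENNReal.ofReal_eq_zero] at h2
  linarith

/-- A bounded function that is monotone on a set of full measure is, up to a constant, almost
everywhere the distribution function of a finite measure. -/
theorem exists_measure_of_monotoneOn {a b : ℝ} {g : ℝ → ℝ} {S : Set ℝ}
    (hS : ∀ᵐ x ∂volume.restrict (Ioo a b), x ∈ S) (hg : MonotoneOn g S)
    (hl : BddBelow (g '' S)) (hu : BddAbove (g '' S)) :
    ∃ ν : Measure (Ioo a b), IsFiniteMeasure ν ∧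
      ∃ c : ℝ, ∀ᵐ x ∂volume.restrict (Ioo a b), g x = c + distribFun ν x := by
  obtain ⟨G, hG, hGg⟩ := hg.exists_monotone_extension hl hu
  have hemb : MeasurableEmbedding (Subtype.val : Ioo a b → ℝ) :=
    MeasurableEmbedding.subtype_coe measurableSet_Ioo
  refine ⟨hG.stieltjesFunction.measure.comap Subtype.val, ⟨?_⟩, hG.stieltjesFunction a, ?_⟩
  · rw [hemb.comap_apply, image_univ, Subtype.range_coe]
    exact (measure_mono Ioo_subset_Icc_self).trans_lt isCompact_Icc.measure_lt_top
  -- A monotone function has countably many discontinuities; elsewhere it equals its right limit,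
  -- which is what the Stieltjes measure sees.
  have hcount := ae_restrict_of_ae (s := Ioo a b) (hG.countable_not_continuousAt.ae_notMem volume)
  filter_upwards [hS, hcount, ae_restrict_mem measurableSet_Ioo] with x hxS hxc hxI
  have hcont : ContinuousAt G x := by simpa using hxc
  have himg : (Subtype.val '' {t : Ioo a b | (t : ℝ) ≤ x}) = Ioc a x := by
    ext t
    simp only [mem_image, mem_ofPred_eq, Subtype.exists, mem_Ioo, exists_and_left, exists_prop,
      mem_Ioc]
    constructor
    · rintro ⟨s, hs, ⟨h1, h2⟩, rfl⟩; exact ⟨h1, hs⟩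
    · rintro ⟨h1, h2⟩; exact ⟨t, h2, ⟨h1, h2.trans_lt hxI.2⟩, rfl⟩
  rw [distribFun, measureReal_def, hemb.comap_apply, himg, StieltjesFunction.measure_Ioc,
    ENNReal.toReal_ofReal (sub_nonneg.2 (hG.stieltjesFunction.mono hxI.1.le)), hGg hxS,
    hG.stieltjesFunction_eq x, rightLim_eq_of_tendsto
      (hcont.tendsto.mono_left nhdsWithin_le_nhds)]
  ring

/-- Distribution functions can be integrated by parts against test functions. -/
theorem integral_distribFun_mul_deriv {a b : ℝ} (ν : Measure (Ioo a b)) [IsFiniteMeasure ν]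
    {ξ : ℝ → ℝ} (hξ : IsTest a b ξ) :
    ∫ x in Ioo a b, distribFun ν x * deriv ξ x = -∫ x : Ioo a b, ξ x ∂ν := by
  have hd : Continuous (deriv ξ) := hξ.contDiff.continuous_deriv le_rfl
  have hint : IntegrableOn (deriv ξ) (Ioo a b) :=
    (hd.continuousOn.integrableOn_compact isCompact_Icc).mono_set Ioo_subset_Icc_self
  set K : Set (ℝ × Ioo a b) := {q | (q.2 : ℝ) ≤ q.1} with hK
  have hKm : MeasurableSet K :=
    measurableSet_le (measurable_subtype_coe.comp measurable_snd) measurable_fst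
  have hprod : Integrable (K.indicator fun q => deriv ξ q.1)
      ((volume.restrict (Ioo a b)).prod ν) := (hint.comp_fst ν).indicator hKm
  have hξb : ξ b = 0 := by
    by_contra h
    exact lt_irrefl b (hξ.tsupport_subset (subset_tsupport ξ h)).2
  calc ∫ x in Ioo a b, distribFun ν x * deriv ξ x
      = ∫ x in Ioo a b, ∫ t, K.indicator (fun q => deriv ξ q.1) (x, t) ∂ν := by
        congr 1 with x
        rw [show (fun t : Ioo a b => K.indicator (fun q => deriv ξ q.1) (x, t)) =
          {t : Ioo a b | (t : ℝ) ≤ x}.indicator fun _ => deriv ξ x from rfl,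
          integral_indicator (measurableSet_coe_le x), setIntegral_const, smul_eq_mul]
        rfl
    _ = ∫ t : Ioo a b, (∫ x : ℝ in Ioo a b, K.indicator (fun q => deriv ξ q.1) (x, t)) ∂ν :=
        integral_integral_swap hprod
    _ = ∫ t : Ioo a b, -ξ t ∂ν := by
        congr 1 with t
        rw [show (fun x : ℝ => K.indicator (fun q => deriv ξ q.1) (x, t)) =
          (Ici (t : ℝ)).indicator fun x : ℝ => deriv ξ x from rfl,
          setIntegral_indicator measurableSet_Ici,
          show Ioo a b ∩ Ici (t : ℝ) = Ico (t : ℝ) b by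
            ext s; simp only [mem_inter_iff, mem_Ioo, mem_Ici, mem_Ico]
            exact ⟨fun h => ⟨h.2, h.1.2⟩, fun h => ⟨⟨t.2.1.trans_le h.1, h.2⟩, h.1⟩⟩,
          integral_Ico_eq_integral_Ioc, ← intervalIntegral.integral_of_le t.2.2.le,
          intervalIntegral.integral_deriv_eq_sub
            (fun x _ => (hξ.contDiff.differentiable one_ne_zero).differentiableAt)
            (hd.intervalIntegrable _ _), hξb, zero_sub]
    _ = -∫ x : Ioo a b, ξ x ∂ν := integral_neg _

theorem tendsto_distribFun_right {a b : ℝ} (ν : Measure (Ioo a b)) [IsFiniteMeasure ν] (x : ℝ) :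
    Tendsto (distribFun ν) (𝓝[>] x) (𝓝 (distribFun ν x)) := by
  have h := tendsto_measure_biInter_gt (μ := ν) (s := fun r : ℝ => {t : Ioo a b | (t : ℝ) ≤ r})
    (a := x) (fun r _ => (measurableSet_coe_le r).nullMeasurableSet)
    (fun i j _ hij t ht => le_trans ht hij) ⟨x + 1, by simp, measure_ne_top _ _⟩
  have hset : (⋂ r > x, {t : Ioo a b | (t : ℝ) ≤ r}) = {t : Ioo a b | (t : ℝ) ≤ x} := by
    ext t
    simp only [mem_iInter, mem_ofPred_eq]
    exact ⟨fun h => le_of_forall_gt_imp_ge_of_dense h, fun h r hr => h.trans hr.le⟩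
  rw [hset] at h
  exact (ENNReal.tendsto_toReal (measure_ne_top _ _)).comp h

/-- A finite measure on `(a, b)` is determined by its distribution function, up to a constant and
a null set. -/
theorem measure_eq_of_distribFun_ae_eq {a b : ℝ} (hab : a < b) {μ ν : Measure (Ioo a b)}
    [IsFiniteMeasure μ] [IsFiniteMeasure ν] {c : ℝ}
    (h : ∀ᵐ x ∂volume.restrict (Ioo a b), distribFun μ x = c + distribFun ν x) : μ = ν := by
  -- Right continuity removes the exceptional null set. The left endpoint is included because both
  -- distribution functions vanish there, which forces `c = 0`.
  have key : ∀ x ∈ Ico a b, distribFun μ x = c + distribFun ν x := by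
    intro x hx
    refine tendsto_nhds_unique_of_frequently_eq (tendsto_distribFun_right μ x)
      ((tendsto_distribFun_right ν x).const_add c) ?_
    rw [(nhdsGT_basis_of_exists_gt ⟨b, hx.2⟩).frequently_iff]
    intro y hy
    obtain ⟨s, hs, hps⟩ := exists_mem_Ioo_of_ae h hx.1 (lt_min hy hx.2) (min_le_right y b)
    exact ⟨s, ⟨hs.1, hs.2.trans_le (min_le_left _ _)⟩, hps⟩
  have hzero : ∀ ν : Measure (Ioo a b), distribFun ν a = 0 := fun ν => by
    rw [distribFun, show {t : Ioo a b | (t : ℝ) ≤ a} = ∅ from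
      eq_empty_of_forall_notMem fun t ht => absurd t.2.1 (not_lt.2 ht), measureReal_empty]
  have hc : c = 0 := by
    have := key a ⟨le_rfl, hab⟩
    rw [hzero, hzero] at this
    linarith
  refine Measure.ext_of_Iic μ ν fun x => ?_
  have := key x ⟨x.2.1.le, x.2.2⟩
  rw [hc, zero_add] at this
  exact (measureReal_eq_measureReal_iff).1 this

theorem hasDistribDeriv_of_ae_eq {a b : ℝ} {u : ℝ → ℝ} {μ ν : Measure (Ioo a b)}
    [IsFiniteMeasure μ] [IsFiniteMeasure ν] {c : ℝ}
    (h : ∀ᵐ x ∂volume.restrict (Ioo a b), u x = c + (distribFun μ x - distribFun ν x)) :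
    HasDistribDeriv a b u (μ.toSignedMeasure - ν.toSignedMeasure) := by
  intro ξ hξ
  set D := μ.toSignedMeasure - ν.toSignedMeasure with hD
  -- `μ` and `ν` need not be mutually singular, so they may differ from the Jordan parts of `D`;
  -- only this balance survives, and it suffices for integrals.
  have hadd : D.toJordanDecomposition.posPart + ν = D.toJordanDecomposition.negPart + μ := by
    rw [← Measure.toSignedMeasure_eq_toSignedMeasure_iff, Measure.toSignedMeasure_add,
      Measure.toSignedMeasure_add]
    have := D.toSignedMeasure_toJordanDecomposition
    rw [JordanDecomposition.toSignedMeasure] at this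
    rw [sub_eq_iff_eq_add] at this
    rw [this, hD]
    abel
  have hξc : Continuous ξ := hξ.contDiff.continuous
  have hd : Continuous (deriv ξ) := hξ.contDiff.continuous_deriv le_rfl
  have hint : IntegrableOn (deriv ξ) (Ioo a b) :=
    (hd.continuousOn.integrableOn_compact isCompact_Icc).mono_set Ioo_subset_Icc_self
  have hi : ∀ (κ : Measure (Ioo a b)) [IsFiniteMeasure κ],
      Integrable (fun x : Ioo a b => ξ x) κ := fun κ _ => by
    obtain ⟨C, hC⟩ := hξ.hasCompactSupport.exists_bound_of_continuous hξc
    exact Integrable.of_bound (hξc.comp continuous_subtype_val).aestronglyMeasurable C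
      (Eventually.of_forall fun x => hC x)
  have hj : ∀ (κ : Measure (Ioo a b)) [IsFiniteMeasure κ],
      IntegrableOn (fun x => distribFun κ x * deriv ξ x) (Ioo a b) := fun κ _ =>
    hint.bdd_mul (c := κ.real univ) (monotone_distribFun κ).measurable.aestronglyMeasurable
      (Eventually.of_forall fun x => abs_distribFun_le κ x)
  have hξ0 : ∫ x in Ioo a b, deriv ξ x = 0 := by
    have h1 : ∀ x, ξ x ≠ 0 → x ∈ Ioo a b := fun x hx => hξ.tsupport_subset (subset_tsupport ξ hx)
    have ha : ξ a = 0 := by by_contra h; exact lt_irrefl a (h1 a h).1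
    have hb : ξ b = 0 := by by_contra h; exact lt_irrefl b (h1 b h).2
    rcases le_or_gt a b with hab | hab
    · rw [← integral_Ioc_eq_integral_Ioo, ← intervalIntegral.integral_of_le hab,
        intervalIntegral.integral_deriv_eq_sub
          (fun x _ => (hξ.contDiff.differentiable one_ne_zero).differentiableAt)
          (hd.intervalIntegrable _ _), ha, hb, sub_zero]
    · simp [Ioo_eq_empty_of_le hab.le]
  have hsum := congrArg (fun κ : Measure (Ioo a b) => ∫ x : Ioo a b, ξ x ∂κ) hadd
  simp only [integral_add_measure (hi _) (hi _)] at hsum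
  have : ∫ x in Ioo a b, u x * deriv ξ x =
      ∫ x in Ioo a b, (c * deriv ξ x +
        (distribFun μ x * deriv ξ x - distribFun ν x * deriv ξ x)) := by
    refine integral_congr_ae ?_
    filter_upwards [h] with x hx
    rw [hx]; ring
  have hsub : IntegrableOn (fun x => distribFun μ x * deriv ξ x - distribFun ν x * deriv ξ x)
      (Ioo a b) := (hj μ).sub (hj ν)
  rw [this, integral_add (hint.const_mul c) hsub, integral_sub (hj μ) (hj ν),
    integral_const_mul, hξ0, integral_distribFun_mul_deriv μ hξ, integral_distribFun_mul_deriv ν hξ]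
  linarith

/-! ### Functions of bounded variation as differences of distribution functions. -/

/-- A function of finite total variation has bounded pointwise variation on the set of points
where its mollifications converge. -/
theorem MemBV.boundedVariationOn {a b : ℝ} {f : ℝ → ℝ} (hf : MemBV a b f) :
    BoundedVariationOn f (mollifyPoints a b f) := by
  refine ne_top_of_le_ne_top hf.2.ne (iSup_le ?_)
  rintro ⟨n, u, hu, huS⟩
  simp only
  -- The signs turn each increment into its absolute value, so the integrals against the derivative
  -- of `ξ k` tend to the variation sum over the partition.
  set s : ℕ → ℝ := fun i => SignType.sign (f (u i) - f (u (i + 1)))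
  set ξ : ℕ → ℝ → ℝ := fun k t => ∑ i ∈ Finset.range n, s i * plateau k (u i) (u (i + 1)) t with hξ
  have hsum : ∑ i ∈ Finset.range n, edist (f (u (i + 1))) (f (u i)) =
      ENNReal.ofReal (∑ i ∈ Finset.range n, s i * (f (u i) - f (u (i + 1)))) := by
    rw [ENNReal.ofReal_sum_of_nonneg fun i _ => by
      rw [sign_mul_self]; exact abs_nonneg _]
    refine Finset.sum_congr rfl fun i _ => ?_
    rw [sign_mul_self, edist_dist, dist_comm, Real.dist_eq]
  have hξd : ∀ k t, HasDerivAt (ξ k)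
      (∑ i ∈ Finset.range n, s i * deriv (plateau k (u i) (u (i + 1))) t) t := fun k t =>
    HasDerivAt.fun_sum fun i _ =>
      ((hasDerivAt_plateau k (u i) (u (i + 1)) t).differentiableAt.hasDerivAt.const_mul (s i))
  have hlim : Tendsto (fun k => ∫ t in Ioo a b, f t * deriv (ξ k) t) atTop
      (𝓝 (∑ i ∈ Finset.range n, s i * (f (u i) - f (u (i + 1))))) := by
    have h1 := tendsto_finsetSum (Finset.range n) fun i _ =>
      (tendsto_integral_mul_deriv_plateau hf.1 (huS i) (huS (i + 1))).const_mul (s i)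
    refine h1.congr fun k => ?_
    simp only [← integral_const_mul]
    rw [← integral_finsetSum]
    · congr 1 with t
      rw [(hξd k t).deriv, Finset.mul_sum]
      exact Finset.sum_congr rfl fun i _ => by ring
    · intro i _
      refine Integrable.const_mul ?_ _
      refine ((integrable_mul_bump hf.1 k (u i)).sub
        (integrable_mul_bump hf.1 k (u (i + 1)))).congr (Eventually.of_forall fun t => ?_)
      simp only [Pi.sub_apply, (hasDerivAt_plateau k _ _ t).deriv]
      ring
  have hbound : ∀ k t, |ξ k t| ≤ 1 := by
    intro k t
    calc |ξ k t| ≤ ∑ i ∈ Finset.range n, |s i * plateau k (u i) (u (i + 1)) t| :=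
          Finset.abs_sum_le_sum_abs _ _
      -- Consecutive plateaus overlap, but their sum telescopes to a difference of two steps, which
      -- keeps the bound 1.
      _ ≤ ∑ i ∈ Finset.range n, (smoothStep k (t - u i) - smoothStep k (t - u (i + 1))) := by
          refine Finset.sum_le_sum fun i _ => ?_
          have h0 := plateau_nonneg (n := k) (hu (Nat.le_succ i)) t
          rw [abs_mul, abs_of_nonneg h0]
          refine mul_le_of_le_one_left h0 ?_
          simp only [s]
          rcases lt_trichotomy (f (u i) - f (u (i + 1))) 0 with h | h | h <;> simp [h]
      _ = smoothStep k (t - u 0) - smoothStep k (t - u n) :=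
          Finset.sum_range_sub' (fun i => smoothStep k (t - u i)) n
      _ ≤ 1 := by
          have h1 := (smoothStep_mem_Icc k (t - u 0)).2
          have h2 := (smoothStep_mem_Icc k (t - u n)).1
          linarith
  have ha := (huS 0).1.1
  have hb := (huS n).1.2
  have htest : ∀ᶠ k in atTop, IsTest a b (ξ k) := by
    have hm : 0 < min (u 0 - a) (b - u n) := lt_min (by linarith) (by linarith)
    filter_upwards [tendsto_one_div_add_one.eventually_lt_const hm] with k hk
    have hk1 := hk.trans_le (min_le_left _ _)
    have hk2 := hk.trans_le (min_le_right _ _)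
    refine isTest_of_tsupport_subset_Icc (c := u 0 - 1 / ((k : ℝ) + 1))
      (d := u n + 1 / ((k : ℝ) + 1)) ?_ ?_ (by linarith) (by linarith)
    · exact ContDiff.sum fun i _ => contDiff_const.mul (contDiff_plateau k _ _)
    · refine closure_minimal (fun t ht => ?_) isClosed_Icc
      by_contra h'
      refine ht (Finset.sum_eq_zero fun i hi => ?_)
      rw [plateau_eq_zero (hu (Nat.le_succ i)), mul_zero]
      refine fun h'' => h' ⟨?_, ?_⟩
      · linarith [h''.1, hu (Nat.zero_le i)]
      · linarith [h''.2, hu (Finset.mem_range.1 hi)]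
  rw [hsum]
  refine le_of_tendsto (ENNReal.tendsto_ofReal hlim) ?_
  filter_upwards [htest] with k hk
  exact le_iSup₂_of_le (ξ k) hk (le_iSup_of_le (hbound k) le_rfl)

/-- The structure of functions of bounded variation on an interval. -/
theorem MemBV.exists_signedMeasure {a b : ℝ} (hab : a < b) {f : ℝ → ℝ} (hf : MemBV a b f) :
    ∃ (D : SignedMeasure (Ioo a b)) (c : ℝ), ∀ᵐ x ∂volume.restrict (Ioo a b),
      f x = c + (distribFun D.toJordanDecomposition.posPart x -
        distribFun D.toJordanDecomposition.negPart x) := by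
  have hS := ae_mem_mollifyPoints hf.1
  set S := mollifyPoints a b f
  have hbv : BoundedVariationOn f S := hf.boundedVariationOn
  obtain ⟨x₀, -, hx₀⟩ := exists_mem_Ioo_of_ae hS le_rfl hab le_rfl
  have hloc := hbv.locallyBoundedVariationOn
  set V := (eVariationOn f S).toReal
  set p := variationOnFromTo f S x₀ with hp
  have hpb : ∀ x, |p x| ≤ V := fun x => variationOnFromTo.abs_le_eVariationOn hbv
  have hfb : ∀ x ∈ S, |f x - f x₀| ≤ V := fun x hx => by
    rw [← Real.dist_eq]; exact hbv.dist_le hx hx₀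
  obtain ⟨μ, hμ, c, hc⟩ := exists_measure_of_monotoneOn hS (variationOnFromTo.monotoneOn hloc hx₀)
    ⟨-V, by rintro _ ⟨x, -, rfl⟩; exact (abs_le.1 (hpb x)).1⟩
    ⟨V, by rintro _ ⟨x, -, rfl⟩; exact (abs_le.1 (hpb x)).2⟩
  -- Jordan's decomposition `f = p - (p - f)`, where both `p` and `p - f` are monotone on `S`.
  obtain ⟨ν, hν, d, hd⟩ := exists_measure_of_monotoneOn hS
    (variationOnFromTo.sub_self_monotoneOn hloc hx₀)
    ⟨-V - V - f x₀, by
      rintro _ ⟨x, hx, rfl⟩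
      have := (abs_le.1 (hpb x)).1
      have := (abs_le.1 (hfb x hx)).2
      simp only [Pi.sub_apply]; linarith⟩
    ⟨V + V - f x₀, by
      rintro _ ⟨x, hx, rfl⟩
      have := (abs_le.1 (hpb x)).2
      have := (abs_le.1 (hfb x hx)).1
      simp only [Pi.sub_apply]; linarith⟩
  set D := μ.toSignedMeasure - ν.toSignedMeasure with hD
  refine ⟨D, c - d, ?_⟩
  filter_upwards [hc, hd] with x hxc hxd
  have h1 := D.apply_eq_posPart_real_sub_negPart_real (measurableSet_coe_le x)
  rw [hD, Measure.toSignedMeasure_sub_apply (measurableSet_coe_le x), ← hD] at h1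
  have h2 : distribFun μ x - distribFun ν x = distribFun D.toJordanDecomposition.posPart x -
      distribFun D.toJordanDecomposition.negPart x := h1
  rw [← h2]
  simp only [Pi.sub_apply] at hxd
  linarith

/-! ### The dual convex set in `L²` and its support function. -/

/-- The Hilbert space `L²(a, b)`. -/
abbrev L2I (a b : ℝ) : Type := Lp ℝ 2 (volume.restrict (Ioo a b))

theorem inner_eq_integral {a b : ℝ} (U W : L2I a b) :
    inner ℝ U W = ∫ x in Ioo a b, U x * W x := by
  rw [L2.inner_def]
  congr 1 with x
  simp [mul_comm]

theorem IsTest.const_mul {a b : ℝ} {ξ : ℝ → ℝ} (h : IsTest a b ξ) (c : ℝ) :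
    IsTest a b fun x => c * ξ x := by
  have hs : tsupport (fun x => c * ξ x) ⊆ tsupport ξ := by
    refine closure_mono fun x hx h0 => hx ?_
    simp only [h0, mul_zero]
  exact ⟨contDiff_const.mul h.contDiff,
    h.hasCompactSupport.of_isClosed_subset (isClosed_tsupport _) hs, hs.trans h.tsupport_subset⟩

theorem IsTest.add {a b : ℝ} {ξ η : ℝ → ℝ} (h : IsTest a b ξ) (h' : IsTest a b η) :
    IsTest a b fun x => ξ x + η x :=
  ⟨h.contDiff.add h'.contDiff, h.hasCompactSupport.add h'.hasCompactSupport,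
    (tsupport_add ξ η).trans (union_subset h.tsupport_subset h'.tsupport_subset)⟩

theorem isTest_zero {a b : ℝ} : IsTest a b fun _ => 0 :=
  ⟨contDiff_const, HasCompactSupport.zero, by simp [tsupport]⟩

theorem IsTest.differentiable {a b : ℝ} {ξ : ℝ → ℝ} (h : IsTest a b ξ) : Differentiable ℝ ξ :=
  h.contDiff.differentiable one_ne_zero

theorem IsTest.continuous_deriv {a b : ℝ} {ξ : ℝ → ℝ} (h : IsTest a b ξ) :
    Continuous (deriv ξ) :=
  h.contDiff.continuous_deriv le_rfl

theorem IsTest.deriv_const_mul {a b : ℝ} {ξ : ℝ → ℝ} (h : IsTest a b ξ) (c : ℝ) :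
    deriv (fun x => c * ξ x) = fun x => c * deriv ξ x :=
  funext fun x => (((h.differentiable x).hasDerivAt).const_mul c).deriv

theorem IsTest.deriv_add {a b : ℝ} {ξ η : ℝ → ℝ} (h : IsTest a b ξ) (h' : IsTest a b η) :
    deriv (fun x => ξ x + η x) = fun x => deriv ξ x + deriv η x :=
  funext fun x => ((h.differentiable x).hasDerivAt.add (h'.differentiable x).hasDerivAt).deriv

theorem IsTest.memLp_deriv {a b : ℝ} {ξ : ℝ → ℝ} (h : IsTest a b ξ) :
    MemLp (deriv ξ) 2 (volume.restrict (Ioo a b)) := by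
  obtain ⟨C, hC⟩ := h.hasCompactSupport.deriv.exists_bound_of_continuous h.continuous_deriv
  exact MemLp.of_bound h.continuous_deriv.aestronglyMeasurable C (Eventually.of_forall hC)

/-- The derivatives of test functions bounded by `lam`, as a subset of `L²(a, b)`. -/
def testDerivs (a b lam : ℝ) : Set (L2I a b) :=
  {W | ∃ ξ : ℝ → ℝ, IsTest a b ξ ∧ (∀ x, |ξ x| ≤ lam) ∧
    W =ᵐ[volume.restrict (Ioo a b)] deriv ξ}

theorem IsTest.toLp_mem_testDerivs {a b lam : ℝ} {ξ : ℝ → ℝ} (h : IsTest a b ξ)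
    (hb : ∀ x, |ξ x| ≤ lam) : h.memLp_deriv.toLp ∈ testDerivs a b lam :=
  ⟨ξ, h, hb, h.memLp_deriv.coeFn_toLp⟩

theorem zero_mem_testDerivs {a b lam : ℝ} (hlam : 0 ≤ lam) : (0 : L2I a b) ∈ testDerivs a b lam := by
  refine ⟨fun _ => 0, isTest_zero, by simpa using hlam, ?_⟩
  filter_upwards [Lp.coeFn_zero ℝ 2 (volume.restrict (Ioo a b))] with x hx
  rw [hx, deriv_const]
  rfl

theorem neg_mem_testDerivs {a b lam : ℝ} {W : L2I a b} (h : W ∈ testDerivs a b lam) :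
    -W ∈ testDerivs a b lam := by
  obtain ⟨ξ, hξ, hb, hW⟩ := h
  refine ⟨fun x => -1 * ξ x, hξ.const_mul _, by simpa using hb, ?_⟩
  filter_upwards [Lp.coeFn_neg W, hW] with x h1 h2
  rw [h1, hξ.deriv_const_mul, Pi.neg_apply, h2]
  ring

theorem convex_testDerivs (a b lam : ℝ) : Convex ℝ (testDerivs a b lam) := by
  rintro V ⟨ξ, hξ, hξb, hV⟩ W ⟨η, hη, hηb, hW⟩ s t hs ht hst
  refine ⟨fun x => s * ξ x + t * η x, (hξ.const_mul s).add (hη.const_mul t), fun x => ?_, ?_⟩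
  · calc |s * ξ x + t * η x| ≤ |s * ξ x| + |t * η x| := abs_add_le _ _
      _ = s * |ξ x| + t * |η x| := by rw [abs_mul, abs_mul, abs_of_nonneg hs, abs_of_nonneg ht]
      _ ≤ s * lam + t * lam := by gcongr <;> [exact hξb x; exact hηb x]
      _ = lam := by rw [← add_mul, hst, one_mul]
  · filter_upwards [Lp.coeFn_add (s • V) (t • W), Lp.coeFn_smul s V, Lp.coeFn_smul t W, hV, hW]
      with x h1 h2 h3 h4 h5
    rw [h1, (hξ.const_mul s).deriv_add (hη.const_mul t), hξ.deriv_const_mul, hη.deriv_const_mul,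
      Pi.add_apply, h2, h3, Pi.smul_apply, Pi.smul_apply, h4, h5]
    rfl

theorem totalVariation_congr {a b : ℝ} {u v : ℝ → ℝ} (h : u =ᵐ[volume.restrict (Ioo a b)] v) :
    totalVariation a b u = totalVariation a b v := by
  unfold totalVariation
  refine iSup_congr fun ξ => iSup_congr fun _ => iSup_congr fun _ => ?_
  congr 1
  refine integral_congr_ae ?_
  filter_upwards [h] with x hx
  rw [hx]

theorem inner_toLp_deriv {a b : ℝ} {ξ : ℝ → ℝ} (U : L2I a b) {W : L2I a b}
    (hW : W =ᵐ[volume.restrict (Ioo a b)] deriv ξ) :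
    inner ℝ U W = ∫ x in Ioo a b, U x * deriv ξ x := by
  rw [inner_eq_integral]
  refine integral_congr_ae ?_
  filter_upwards [hW] with x hx
  rw [hx]

theorem mul_totalVariation_le {a b lam : ℝ} (hlam : 0 < lam) {U : L2I a b} {M : ℝ}
    (h : ∀ W ∈ testDerivs a b lam, inner ℝ U W ≤ M) :
    ENNReal.ofReal lam * totalVariation a b U ≤ ENNReal.ofReal M := by
  simp only [totalVariation, ENNReal.mul_iSup]
  refine iSup_le fun ξ => iSup_le fun hξ => iSup_le fun hb => ?_
  rw [← ENNReal.ofReal_mul hlam.le]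
  refine ENNReal.ofReal_le_ofReal ?_
  have hb' : ∀ x, |lam * ξ x| ≤ lam := fun x => by
    rw [abs_mul, abs_of_pos hlam]
    exact mul_le_of_le_one_right hlam.le (hb x)
  have := h _ ((hξ.const_mul lam).toLp_mem_testDerivs hb')
  rw [inner_toLp_deriv U (hξ.const_mul lam).memLp_deriv.coeFn_toLp, hξ.deriv_const_mul] at this
  rw [← integral_const_mul]
  refine le_of_eq_of_le ?_ this
  congr 1 with x
  ring

/-- With `mul_totalVariation_le`, this identifies λJ with the support function of `testDerivs`. The
closure matters because the projection need not be the derivative of a test function. -/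
theorem ofReal_inner_le {a b lam : ℝ} (hlam : 0 < lam) (V : L2I a b) {W : L2I a b}
    (hW : W ∈ closure (testDerivs a b lam)) :
    ENNReal.ofReal (inner ℝ V W) ≤ ENNReal.ofReal lam * totalVariation a b V := by
  have hcl : IsClosed {W : L2I a b |
      ENNReal.ofReal (inner ℝ V W) ≤ ENNReal.ofReal lam * totalVariation a b V} :=
    isClosed_le (ENNReal.continuous_ofReal.comp (continuous_const.inner continuous_id))
      continuous_const
  refine closure_minimal ?_ hcl hW
  rintro W ⟨ξ, hξ, hb, hWξ⟩
  have hb' : ∀ x, |lam⁻¹ * ξ x| ≤ 1 := fun x => by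
    rw [abs_mul, abs_of_pos (inv_pos.2 hlam), inv_mul_le_one₀ hlam]
    exact hb x
  have h1 : ENNReal.ofReal (∫ x in Ioo a b, V x * deriv (fun x => lam⁻¹ * ξ x) x) ≤
      totalVariation a b V :=
    le_iSup₂_of_le (fun x => lam⁻¹ * ξ x) (hξ.const_mul _) (le_iSup_of_le hb' le_rfl)
  have h2 : inner ℝ V W = lam * ∫ x in Ioo a b, V x * deriv (fun x => lam⁻¹ * ξ x) x := by
    rw [inner_toLp_deriv V hWξ, hξ.deriv_const_mul, ← integral_const_mul]
    congr 1 with x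
    field_simp
  rw [mem_ofPred_eq, h2, ENNReal.ofReal_mul hlam.le]
  gcongr

/-! ### Projection of the datum and the minimizer. -/

theorem exists_projection {a b lam : ℝ} (hlam : 0 ≤ lam) (F : L2I a b) :
    ∃ p ∈ closure (testDerivs a b lam), ∀ W ∈ closure (testDerivs a b lam),
      inner ℝ (F - p) W ≤ inner ℝ (F - p) p := by
  have hconv := (convex_testDerivs a b lam).closure
  obtain ⟨p, hp, hmin⟩ := exists_norm_eq_iInf_of_complete_convex
    (K := closure (testDerivs a b lam)) ⟨0, subset_closure (zero_mem_testDerivs hlam)⟩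
    isClosed_closure.isComplete hconv F
  refine ⟨p, hp, fun W hW => ?_⟩
  have := (norm_eq_iInf_iff_real_inner_le_zero hconv hp).1 hmin W hW
  rw [inner_sub_right] at this
  linarith

theorem lintegral_enorm_sq {a b : ℝ} (g : ℝ → ℝ) :
    ∫⁻ x in Ioo a b, ‖g x‖ₑ ^ 2 = eLpNorm g 2 (volume.restrict (Ioo a b)) ^ 2 := by
  have := eLpNorm_nnreal_pow_eq_lintegral (f := g) (μ := volume.restrict (Ioo a b)) (p := 2)
    two_ne_zero
  simp only [NNReal.coe_ofNat, ENNReal.rpow_ofNat, ENNReal.coe_ofNat] at this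
  exact this.symm

theorem lintegral_enorm_sq_eq_norm {a b : ℝ} {g : ℝ → ℝ} (G : L2I a b)
    (h : g =ᵐ[volume.restrict (Ioo a b)] G) :
    ∫⁻ x in Ioo a b, ‖g x‖ₑ ^ 2 = ENNReal.ofReal (‖G‖ ^ 2) := by
  rw [lintegral_enorm_sq, eLpNorm_congr_ae h, Lp.norm_def,
    ENNReal.ofReal_pow ENNReal.toReal_nonneg, ENNReal.ofReal_toReal (Lp.eLpNorm_ne_top G)]

theorem energy_eq {a b lam : ℝ} {f u : ℝ → ℝ} (G : L2I a b)
    (h : (fun x => f x - u x) =ᵐ[volume.restrict (Ioo a b)] G) :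
    energy a b lam f u =
      ENNReal.ofReal lam * totalVariation a b u + ENNReal.ofReal (‖G‖ ^ 2 / 2) := by
  rw [energy, lintegral_enorm_sq_eq_norm G h, div_eq_inv_mul, ENNReal.ofReal_mul (by norm_num),
    ENNReal.ofReal_inv_of_pos two_pos, ENNReal.ofReal_ofNat]

section Minimizer

variable {a b lam : ℝ} {f u : ℝ → ℝ} {U p : L2I a b}

theorem energy_le_of_dual (hlam : 0 < lam)
    (hvar : ∀ W ∈ closure (testDerivs a b lam), inner ℝ U W ≤ inner ℝ U p)
    (hu : u =ᵐ[volume.restrict (Ioo a b)] U)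
    (hfu : (fun x => f x - u x) =ᵐ[volume.restrict (Ioo a b)] p) :
    energy a b lam f u ≤ ENNReal.ofReal (inner ℝ U p + ‖p‖ ^ 2 / 2) := by
  have h0 : 0 ≤ inner ℝ U p := by
    simpa using hvar 0 (subset_closure (zero_mem_testDerivs hlam.le))
  rw [energy_eq p hfu, ENNReal.ofReal_add h0 (by positivity), totalVariation_congr hu]
  gcongr
  exact mul_totalVariation_le hlam fun W hW => hvar W (subset_closure hW)

/-- Bounding λJ(V) below by ⟨V, p⟩ and expanding the square leaves the excess `‖V - U‖ ^ 2 / 2`.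
This excess gives uniqueness as well as minimality. -/
theorem le_energy_of_dual (hlam : 0 < lam) (hp : p ∈ closure (testDerivs a b lam))
    {v : ℝ → ℝ} {V : L2I a b} (hv : v =ᵐ[volume.restrict (Ioo a b)] V)
    (hu : u =ᵐ[volume.restrict (Ioo a b)] U)
    (hfu : (fun x => f x - u x) =ᵐ[volume.restrict (Ioo a b)] p) :
    ENNReal.ofReal (inner ℝ U p + ‖p‖ ^ 2 / 2 + ‖V - U‖ ^ 2 / 2) ≤ energy a b lam f v := by
  have hG : (fun x => f x - v x) =ᵐ[volume.restrict (Ioo a b)] (p - (V - U) : L2I a b) := by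
    filter_upwards [hv, hu, hfu, Lp.coeFn_sub p (V - U), Lp.coeFn_sub V U] with x h1 h2 h3 h4 h5
    simp only [h4, Pi.sub_apply, h5, ← h1, ← h2, ← h3]
    ring
  have hnorm := norm_sub_sq_real p (V - U)
  rw [inner_sub_right, real_inner_comm V p, real_inner_comm U p] at hnorm
  rw [energy_eq _ hG, totalVariation_congr hv,
    show inner ℝ U p + ‖p‖ ^ 2 / 2 + ‖V - U‖ ^ 2 / 2 =
      inner ℝ V p + ‖p - (V - U)‖ ^ 2 / 2 by rw [hnorm]; ring]
  refine ENNReal.ofReal_add_le.trans ?_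
  gcongr
  exact ofReal_inner_le hlam V hp

/-- Competitors are only assumed integrable; finite energy is what places them in the Hilbert space.
-/
theorem exists_toLp_of_energy_lt_top {v : ℝ → ℝ} (hf : MemLp f 2 (volume.restrict (Ioo a b)))
    (hv : MemBV a b v) (hE : energy a b lam f v < ∞) :
    ∃ V : L2I a b, v =ᵐ[volume.restrict (Ioo a b)] V := by
  have h1 : ∫⁻ x in Ioo a b, ‖f x - v x‖ₑ ^ 2 < ∞ := by
    have := (le_add_self.trans_lt hE : 2⁻¹ * ∫⁻ x in Ioo a b, ‖f x - v x‖ₑ ^ 2 < ∞)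
    by_contra! h
    rw [top_le_iff.1 h, ENNReal.mul_top (by simp)] at this
    exact lt_irrefl _ this
  rw [lintegral_enorm_sq fun x => f x - v x, ENNReal.pow_lt_top_iff] at h1
  have hfv : MemLp (fun x => f x - v x) 2 (volume.restrict (Ioo a b)) :=
    ⟨hf.1.sub hv.1.1, by simpa using h1⟩
  have hvL : MemLp v 2 (volume.restrict (Ioo a b)) := by
    refine (hf.sub hfv).ae_eq (Eventually.of_forall fun x => ?_)
    simp
  exact ⟨hvL.toLp, hvL.coeFn_toLp.symm⟩

/-- The dual characterization of minimizers. -/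
theorem isMinimizer_of_dual (hlam : 0 < lam) (hf : MemLp f 2 (volume.restrict (Ioo a b)))
    (hp : p ∈ closure (testDerivs a b lam))
    (hvar : ∀ W ∈ closure (testDerivs a b lam), inner ℝ U W ≤ inner ℝ U p)
    (hu : u =ᵐ[volume.restrict (Ioo a b)] U)
    (hfu : (fun x => f x - u x) =ᵐ[volume.restrict (Ioo a b)] p) :
    IsMinimizer a b lam f u ∧
      ∀ v, IsMinimizer a b lam f v → v =ᵐ[volume.restrict (Ioo a b)] u := by
  have hup := energy_le_of_dual hlam hvar hu hfu
  have hBV : MemBV a b u := by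
    refine ⟨((Lp.memLp U).integrable one_le_two).congr hu.symm, ?_⟩
    have := (le_self_add.trans hup).trans_lt ENNReal.ofReal_lt_top
    exact ENNReal.lt_top_of_mul_ne_top_right this.ne (by simpa using hlam)
  have hmin : IsMinimizer a b lam f u := by
    refine ⟨hBV, fun v hv => ?_⟩
    rcases eq_top_or_lt_top (energy a b lam f v) with hE | hE
    · rw [hE]; exact le_top
    obtain ⟨V, hV⟩ := exists_toLp_of_energy_lt_top hf hv hE
    refine hup.trans (le_trans ?_ (le_energy_of_dual hlam hp hV hu hfu))
    exact ENNReal.ofReal_le_ofReal (le_add_of_nonneg_right (by positivity))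
  refine ⟨hmin, fun v hv => ?_⟩
  have hvu := (hv.2 u hBV).trans hup
  obtain ⟨V, hV⟩ := exists_toLp_of_energy_lt_top hf hv.1 (hvu.trans_lt ENNReal.ofReal_lt_top)
  have hle := (le_energy_of_dual hlam hp hV hu hfu).trans hvu
  have h0 : 0 ≤ inner ℝ U p := by
    simpa using hvar 0 (subset_closure (zero_mem_testDerivs hlam.le))
  rw [ENNReal.ofReal_le_ofReal_iff (by positivity)] at hle
  have hVU : V = U := by
    rw [← sub_eq_zero, ← norm_eq_zero]
    nlinarith [norm_nonneg (V - U)]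
  exact hV.trans (hVU ▸ hu.symm)

end Minimizer

/-! ### The primitive of the dual variable. -/

/-- Primitives of `L²` functions are given by inner products with bounded elements. -/
theorem exists_inner_eq_primitive {a b x : ℝ} (hx : x ∈ Icc a b) :
    ∃ e : L2I a b, ‖e‖ ≤ √(b - a) ∧ ∀ W : L2I a b, ∫ t in a..x, W t = inner ℝ e W := by
  refine ⟨indicatorConstLp 2 (measurableSet_Ioo (a := a) (b := x)) (measure_ne_top _ _) (1 : ℝ),
    ?_, fun W => ?_⟩
  · rw [norm_indicatorConstLp two_ne_zero ENNReal.ofNat_ne_top, norm_one, one_mul,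
      measureReal_restrict_apply measurableSet_Ioo, Ioo_inter_Ioo, sup_idem, inf_of_le_left hx.2,
      Real.volume_real_Ioo_of_le hx.1, ENNReal.toReal_ofNat, ← Real.sqrt_eq_rpow]
    exact Real.sqrt_le_sqrt (by linarith [hx.2])
  · rw [L2.inner_indicatorConstLp_one, Measure.restrict_restrict measurableSet_Ioo, Ioo_inter_Ioo,
      sup_idem, inf_of_le_left hx.2, intervalIntegral.integral_of_le hx.1,
      integral_Ioc_eq_integral_Ioo]

theorem abs_primitive_le {a b x : ℝ} (hx : x ∈ Icc a b) (W : L2I a b) :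
    |∫ t in a..x, W t| ≤ √(b - a) * ‖W‖ := by
  obtain ⟨e, he, h⟩ := exists_inner_eq_primitive hx
  rw [h]
  exact (abs_real_inner_le_norm e W).trans (by gcongr)

theorem integrableOn_L2I {a b : ℝ} (W : L2I a b) : IntegrableOn W (Ioo a b) :=
  (Lp.memLp W).integrable one_le_two

theorem intervalIntegrable_L2I {a b x y : ℝ} (W : L2I a b) (hx : x ∈ Icc a b) (hy : y ∈ Icc a b) :
    IntervalIntegrable W volume x y := by
  have h : IntegrableOn W (Icc a b) := by
    rw [integrableOn_Icc_iff_integrableOn_Ioo]; exact integrableOn_L2I W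
  exact (h.mono_set (uIcc_subset_Icc hx hy)).intervalIntegrable

theorem primitive_sub_primitive {a b x y : ℝ} (W : L2I a b) (hx : x ∈ Icc a b) (hy : y ∈ Icc a b) :
    (∫ t in a..y, W t) - ∫ t in a..x, W t = ∫ t in x..y, W t := by
  have ha : a ∈ Icc a b := ⟨le_rfl, hx.1.trans hx.2⟩
  exact intervalIntegral.integral_interval_sub_left (intervalIntegrable_L2I W ha hy)
    (intervalIntegrable_L2I W ha hx)

theorem continuousOn_primitive_L2I {a b : ℝ} (W : L2I a b) :
    ContinuousOn (fun x => ∫ t in a..x, W t) (Icc a b) := by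
  rcases le_or_gt a b with hab | hab
  · rw [← uIcc_of_le hab]
    refine intervalIntegral.continuousOn_primitive_interval ?_
    rw [uIcc_of_le hab]
    exact (integrableOn_Icc_iff_integrableOn_Ioo (by simp) (by simp)).2 (integrableOn_L2I W)
  · simp [Icc_eq_empty_of_lt hab]

theorem primitive_of_ae_eq_deriv {a b x : ℝ} {ξ : ℝ → ℝ} (hξ : IsTest a b ξ) {W : L2I a b}
    (hW : W =ᵐ[volume.restrict (Ioo a b)] deriv ξ) (hx : x ∈ Icc a b) :
    ∫ t in a..x, W t = ξ x := by
  have hξa : ξ a = 0 := by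
    by_contra h
    exact lt_irrefl a (hξ.tsupport_subset (subset_tsupport ξ h)).1
  have h1 : ∫ t in a..x, W t = ∫ t in a..x, deriv ξ t := by
    rw [intervalIntegral.integral_of_le hx.1, intervalIntegral.integral_of_le hx.1,
      integral_Ioc_eq_integral_Ioo, integral_Ioc_eq_integral_Ioo]
    exact integral_congr_ae
      (ae_restrict_of_ae_restrict_of_subset (Ioo_subset_Ioo le_rfl hx.2) hW)
  rw [h1, intervalIntegral.integral_deriv_eq_sub
    (fun x _ => hξ.differentiable x) (hξ.continuous_deriv.intervalIntegrable _ _), hξa, sub_zero]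

/-- On `testDerivs` the primitive is the test function itself; evaluating a primitive is
`L²`-continuous, so the bound passes to the closure. -/
theorem abs_primitive_le_of_mem_closure {a b lam x : ℝ} {p : L2I a b}
    (hp : p ∈ closure (testDerivs a b lam)) (hx : x ∈ Icc a b) : |∫ t in a..x, p t| ≤ lam := by
  obtain ⟨e, -, h⟩ := exists_inner_eq_primitive hx
  have hcl : IsClosed {W : L2I a b | |inner ℝ e W| ≤ lam} :=
    isClosed_le (continuous_const.inner continuous_id).abs continuous_const
  rw [h]
  refine closure_minimal ?_ hcl hp
  rintro W ⟨ξ, hξ, hb, hW⟩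
  rw [mem_ofPred_eq, ← h, primitive_of_ae_eq_deriv hξ hW hx]
  exact hb x

/-! ### Monotonicity of the minimizer off the contact sets. -/

/-- Where the optimal dual variable stays above its lower bound, the minimizer is nonincreasing
in the sense of distributions. -/
theorem integral_mul_deriv_nonneg_of_lt_primitive {a b lam : ℝ} {U p : L2I a b}
    (hp : p ∈ closure (testDerivs a b lam))
    (hvar : ∀ W ∈ closure (testDerivs a b lam), inner ℝ U W ≤ inner ℝ U p)
    {ξ : ℝ → ℝ} (hξ : IsTest a b ξ) (hξ0 : ∀ x, 0 ≤ ξ x)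
    (hz : ∀ x ∈ tsupport ξ, -lam < ∫ t in a..x, p t) :
    0 ≤ ∫ x in Ioo a b, U x * deriv ξ x := by
  obtain ⟨m, hm, hmz⟩ := hξ.hasCompactSupport.isCompact.exists_forall_le'
    ((continuousOn_primitive_L2I p).mono (hξ.tsupport_subset.trans Ioo_subset_Icc_self)) hz
  obtain ⟨C, hC⟩ := hξ.hasCompactSupport.exists_bound_of_continuous hξ.contDiff.continuous
  have hC0 : 0 ≤ C := (norm_nonneg _).trans (hC 0)
  -- Half of the gap `m + lam` pays for replacing the primitive of `p` by a test function `η`, the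
  -- other half for subtracting `ε * ξ`.
  set δ := (m + lam) / 2 with hδ
  have hδ0 : 0 < δ := by simp only [hδ]; linarith
  set ε := δ / (C + 1) with hε
  have hε0 : 0 < ε := by positivity
  have hεξ : ∀ x, ε * ξ x ≤ δ := fun x => by
    calc ε * ξ x ≤ ε * (C + 1) := by
          gcongr
          linarith [(le_abs_self (ξ x)).trans (hC x)]
      _ = δ := by rw [hε]; field_simp
  set Ξ : L2I a b := hξ.memLp_deriv.toLp with hΞ
  have hmem : p - ε • Ξ ∈ closure (testDerivs a b lam) := by
    rw [Metric.mem_closure_iff]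
    intro r hr
    -- `L²` closeness controls primitives uniformly with factor `√(b - a)`; the `+ 1` only keeps the
    -- denominator positive.
    obtain ⟨W, ⟨η, hη, hηb, hW⟩, hd⟩ := Metric.mem_closure_iff.1 hp
      (min r (δ / (√(b - a) + 1))) (lt_min hr (by positivity))
    refine ⟨W - ε • Ξ, ⟨fun x => η x + -ε * ξ x, hη.add (hξ.const_mul _), fun x => ?_, ?_⟩, ?_⟩
    · have h1 := abs_le.1 (hηb x)
      have h2 : 0 ≤ ε * ξ x := mul_nonneg hε0.le (hξ0 x)
      refine abs_le.2 ⟨?_, by linarith [h1.2]⟩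
      by_cases hx : x ∈ tsupport ξ
      · have hxI := Ioo_subset_Icc_self (hξ.tsupport_subset hx)
        have h3 := abs_primitive_le hxI (p - W)
        have h4 : ∫ t in a..x, (p - W : L2I a b) t = (∫ t in a..x, p t) - η x := by
          obtain ⟨e, -, he⟩ := exists_inner_eq_primitive hxI
          rw [← primitive_of_ae_eq_deriv hη hW hxI, he, he, he, inner_sub_right]
        have h5 : √(b - a) * ‖p - W‖ ≤ δ := by
          calc √(b - a) * ‖p - W‖ ≤ (√(b - a) + 1) * (δ / (√(b - a) + 1)) := by
                rw [← dist_eq_norm]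
                gcongr
                · linarith
                · exact (hd.trans_le (min_le_right _ _)).le
            _ = δ := by field_simp
        rw [h4] at h3
        have h6 := (abs_le.1 (h3.trans h5)).2
        have h7 := hmz x hx
        have h8 := hεξ x
        linarith
      · have h3 : ξ x = 0 := image_eq_zero_of_notMem_tsupport hx
        simp only [h3, mul_zero, add_zero]
        exact h1.1
    · filter_upwards [Lp.coeFn_sub W (ε • Ξ), Lp.coeFn_smul ε Ξ, hW, hξ.memLp_deriv.coeFn_toLp]
        with x h1 h2 h3 h4
      rw [h1, Pi.sub_apply, h2, Pi.smul_apply, h3, hΞ, h4, hη.deriv_add (hξ.const_mul _),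
        hξ.deriv_const_mul, smul_eq_mul]
      ring
    · rw [dist_sub_right]
      exact hd.trans_le (min_le_left _ _)
  have h := hvar _ hmem
  rw [inner_sub_right, inner_smul_right, inner_toLp_deriv U hξ.memLp_deriv.coeFn_toLp] at h
  exact nonneg_of_mul_nonneg_right (by linarith) hε0

theorem le_of_lt_primitive {a b lam : ℝ} {U p : L2I a b} {u : ℝ → ℝ}
    (hp : p ∈ closure (testDerivs a b lam))
    (hvar : ∀ W ∈ closure (testDerivs a b lam), inner ℝ U W ≤ inner ℝ U p)
    (hu : u =ᵐ[volume.restrict (Ioo a b)] U) {x y : ℝ} (hxy : x ≤ y)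
    (hx : x ∈ mollifyPoints a b u) (hy : y ∈ mollifyPoints a b u)
    (hz : ∀ t ∈ Icc x y, -lam < ∫ s in a..t, p s) : u y ≤ u x := by
  -- Plateaus spill slightly beyond `[x, y]`, so the strict inequality must be extended to
  -- neighbourhoods of both endpoints.
  have hO : IsOpen (Ioo a b ∩ (fun t => ∫ s in a..t, p s) ⁻¹' Ioi (-lam)) :=
    ((continuousOn_primitive_L2I p).mono Ioo_subset_Icc_self).isOpen_inter_preimage isOpen_Ioo
      isOpen_Ioi
  obtain ⟨δ, hδ, hxδ⟩ := Metric.isOpen_iff.1 hO x ⟨hx.1, hz x ⟨le_rfl, hxy⟩⟩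
  obtain ⟨δ', hδ', hyδ⟩ := Metric.isOpen_iff.1 hO y ⟨hy.1, hz y ⟨hxy, le_rfl⟩⟩
  have hlim := tendsto_integral_mul_deriv_plateau
    ((integrableOn_L2I U).congr hu.symm) hx hy
  refine sub_nonneg.1 (ge_of_tendsto hlim ?_)
  filter_upwards [tendsto_one_div_add_one.eventually_lt_const (lt_min hδ hδ')] with n hn
  have hn1 := hn.trans_le (min_le_left _ _)
  have hn2 := hn.trans_le (min_le_right _ _)
  have hsub : Icc (x - 1 / ((n : ℝ) + 1)) (y + 1 / ((n : ℝ) + 1)) ⊆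
      Ioo a b ∩ (fun t => ∫ s in a..t, p s) ⁻¹' Ioi (-lam) := by
    intro t ht
    rcases lt_or_ge t x with h1 | h1
    · refine hxδ ?_
      rw [Metric.mem_ball, Real.dist_eq, abs_lt]
      constructor <;> linarith [ht.1]
    rcases le_or_gt t y with h2 | h2
    · exact ⟨⟨hx.1.1.trans_le h1, h2.trans_lt hy.1.2⟩, hz t ⟨h1, h2⟩⟩
    · refine hyδ ?_
      rw [Metric.mem_ball, Real.dist_eq, abs_lt]
      constructor <;> linarith [ht.2]
  have hts := (tsupport_plateau_subset (n := n) hxy).trans hsub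
  have htest : IsTest a b (plateau n x y) :=
    ⟨contDiff_plateau n x y, isCompact_Icc.of_isClosed_subset (isClosed_tsupport _)
      (tsupport_plateau_subset hxy), hts.trans inter_subset_left⟩
  have := integral_mul_deriv_nonneg_of_lt_primitive hp hvar htest (plateau_nonneg hxy)
    fun t ht => (hts ht).2
  refine this.trans_eq (integral_congr_ae ?_)
  filter_upwards [hu] with t ht
  rw [ht]

theorem mollifyPoints_neg {a b : ℝ} {u : ℝ → ℝ} {x : ℝ} (hx : x ∈ mollifyPoints a b u) :
    x ∈ mollifyPoints a b fun t => -u t := by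
  refine ⟨hx.1, hx.2.neg.congr fun n => ?_⟩
  rw [← integral_neg]
  congr 1 with t
  ring

/-- The dual set is symmetric, so `le_of_lt_primitive` applies to `-U`, `-p` and `-u`. -/
theorem ge_of_primitive_lt {a b lam : ℝ} {U p : L2I a b} {u : ℝ → ℝ}
    (hp : p ∈ closure (testDerivs a b lam))
    (hvar : ∀ W ∈ closure (testDerivs a b lam), inner ℝ U W ≤ inner ℝ U p)
    (hu : u =ᵐ[volume.restrict (Ioo a b)] U) {x y : ℝ} (hxy : x ≤ y)
    (hx : x ∈ mollifyPoints a b u) (hy : y ∈ mollifyPoints a b u)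
    (hz : ∀ t ∈ Icc x y, ∫ s in a..t, p s < lam) : u x ≤ u y := by
  have hneg : ∀ W ∈ closure (testDerivs a b lam), -W ∈ closure (testDerivs a b lam) := fun W hW =>
    map_mem_closure continuous_neg hW fun _ h => neg_mem_testDerivs h
  refine neg_le_neg_iff.1 (le_of_lt_primitive (U := -U) (u := fun t => -u t) (hneg p hp)
    (fun W hW => ?_) ?_ hxy (mollifyPoints_neg hx) (mollifyPoints_neg hy) fun t ht => ?_)
  · simpa using hvar _ (hneg W hW)
  · filter_upwards [hu, Lp.coeFn_neg U] with t h1 h2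
    rw [h2, h1, Pi.neg_apply]
  · have htI : t ∈ Icc a b := ⟨hx.1.1.le.trans ht.1, ht.2.trans hy.1.2.le⟩
    obtain ⟨e, -, he⟩ := exists_inner_eq_primitive htI
    rw [he, inner_neg_right, ← he]
    linarith [hz t ht]

/-! ### The obstacle argument and the measure inequalities. -/

/-- If `z' = v - N` with `N` monotone, and `v` is monotone as long as `z` stays above its lower
bound, then `v` is monotone. -/
theorem monotoneOn_of_obstacle {a b m : ℝ} {z v N : ℝ → ℝ} {G : Set ℝ}
    (hG : ∀ᵐ x ∂volume.restrict (Ioo a b), x ∈ G) (hGI : G ⊆ Ioo a b)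
    (hzc : ContinuousOn z (Ioo a b)) (hz : ∀ x ∈ Ioo a b, m ≤ z x)
    (hder : ∀ x ∈ G, HasDerivAt z (v x - N x) x) (hN : Monotone N)
    (hint : ∀ x ∈ Ioo a b, ∀ y ∈ Ioo a b, x ≤ y →
      IntervalIntegrable (fun t => v t - N t) volume x y ∧
        z y - z x = ∫ t in x..y, (v t - N t))
    (hoff : ∀ x ∈ G, ∀ y ∈ G, x ≤ y → (∀ t ∈ Icc x y, m < z t) → v x ≤ v y) :
    MonotoneOn v G := by
  intro x hx y hy hxy
  set K := Icc x y ∩ z ⁻¹' {m}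
  have hIcc : Icc x y ⊆ Ioo a b := Icc_subset_Ioo (hGI hx).1 (hGI hy).2
  have hK : IsCompact K := isCompact_Icc.of_isClosed_subset
    ((hzc.mono hIcc).preimage_isClosed_of_isClosed isClosed_Icc isClosed_singleton)
    inter_subset_left
  rcases K.eq_empty_or_nonempty with hKe | hKn
  · refine hoff x hx y hy hxy fun t ht => (hz t (hIcc ht)).lt_of_ne fun h => ?_
    exact (hKe ▸ notMem_empty t : t ∉ K) ⟨ht, h.symm⟩
  have hcrit : ∀ s ∈ G, z s = m → v s = N s := fun s hs hsm => by
    have hmin : IsLocalMin z s := by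
      filter_upwards [isOpen_Ioo.mem_nhds (hGI hs)] with t ht
      rw [hsm]; exact hz t ht
    exact sub_eq_zero.1 (hmin.hasDerivAt_eq_zero (hder s hs))
  have habove : ∀ t ∈ Icc x y, t ∉ K → m < z t := fun t ht htK =>
    (hz t (hIcc ht)).lt_of_ne fun h => htK ⟨ht, h.symm⟩
  -- Before the first contact `v` is at least `v x` and `N` at most `N (sInf K)`. If the claim
  -- failed, `z` would strictly increase from `x` to a point where it takes its least allowed value
  -- `m`.
  have hfirst : v x ≤ N (sInf K) := by
    obtain ⟨hsI, hsm⟩ := hK.sInf_mem hKn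
    rcases hsI.1.eq_or_lt with h | h
    · rw [← h]; rw [← h] at hsm; exact (hcrit x hx hsm).le
    by_contra! hlt
    obtain ⟨h1, h2⟩ := hint x (hGI hx) _ (hIcc hsI) h.le
    have h3 : ∫ _ in x..sInf K, (v x - N (sInf K)) ≤ ∫ t in x..sInf K, (v t - N t) := by
      refine intervalIntegral.integral_mono_ae_restrict h.le (by simp) h1 ?_
      rw [← restrict_Ioo_eq_restrict_Icc]
      filter_upwards [ae_restrict_of_ae_restrict_of_subset
        (Ioo_subset_Ioo (hGI hx).1.le (hIcc hsI).2.le) hG, ae_restrict_mem measurableSet_Ioo]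
        with t htG ht
      refine sub_le_sub (hoff x hx t htG ht.1.le fun r hr => ?_) (hN ht.2.le)
      exact habove r ⟨hr.1, hr.2.trans (ht.2.le.trans hsI.2)⟩
        fun hrK => absurd (csInf_le hK.bddBelow hrK) (not_le.2 (hr.2.trans_lt ht.2))
    rw [intervalIntegral.integral_const, smul_eq_mul, ← h2] at h3
    have h4 := mul_pos (sub_pos.2 h) (sub_pos.2 hlt)
    have h5 := hz x (hGI hx)
    rw [mem_preimage, mem_singleton_iff] at hsm
    linarith
  -- Symmetrically, failure here would make `z` drop below `m` between the last contact and `y`.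
  have hlast : N (sSup K) ≤ v y := by
    obtain ⟨hsI, hsm⟩ := hK.sSup_mem hKn
    rcases hsI.2.eq_or_lt with h | h
    · rw [h]; rw [h] at hsm; exact (hcrit y hy hsm).ge
    by_contra! hlt
    obtain ⟨h1, h2⟩ := hint _ (hIcc hsI) y (hGI hy) h.le
    have h3 : ∫ t in sSup K..y, (v t - N t) ≤ ∫ _ in sSup K..y, (v y - N (sSup K)) := by
      refine intervalIntegral.integral_mono_ae_restrict h.le h1 (by simp) ?_
      rw [← restrict_Ioo_eq_restrict_Icc]
      filter_upwards [ae_restrict_of_ae_restrict_of_subset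
        (Ioo_subset_Ioo (hIcc hsI).1.le (hGI hy).2.le) hG, ae_restrict_mem measurableSet_Ioo]
        with t htG ht
      refine sub_le_sub (hoff t htG y hy ht.2.le fun r hr => ?_) (hN ht.1.le)
      exact habove r ⟨hsI.1.trans (ht.1.le.trans hr.1), hr.2⟩
        fun hrK => absurd (le_csSup hK.bddAbove hrK) (not_le.2 (ht.1.trans_le hr.1))
    rw [intervalIntegral.integral_const, smul_eq_mul, ← h2] at h3
    have h4 := mul_pos (sub_pos.2 h) (sub_pos.2 hlt)
    have h5 := hz y (hGI hy)
    rw [mem_preimage, mem_singleton_iff] at hsm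
    linarith
  exact hfirst.trans ((hN (csInf_le_csSup hKn hK.bddBelow hK.bddAbove)).trans hlast)

/-- Fix one point of `G`. On one side of it monotonicity of `v` gives the bound; on the other,
monotonicity of `w` together with the bounded sum does. -/
theorem bounded_image_of_monotoneOn_add {v w : ℝ → ℝ} {G : Set ℝ} {M : ℝ}
    (hv : MonotoneOn v G) (hw : MonotoneOn w G) (h : ∀ x ∈ G, |v x + w x| ≤ M) :
    BddBelow (v '' G) ∧ BddAbove (v '' G) := by
  rcases G.eq_empty_or_nonempty with rfl | ⟨y, hy⟩
  · simp
  refine ⟨⟨min (v y) (-M - w y), ?_⟩, ⟨max (v y) (M - w y), ?_⟩⟩ <;> rintro _ ⟨x, hx, rfl⟩ <;>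
    have hM := abs_le.1 (h x hx) <;> rcases le_total x y with hxy | hxy
  · exact min_le_of_right_le (by linarith [hw hx hy hxy])
  · exact min_le_of_left_le (hv hy hx hxy)
  · exact le_max_of_le_left (hv hx hy hxy)
  · exact le_max_of_le_right (by linarith [hw hy hx hxy])

end ROF

theorem theorem2 (a b : ℝ) (hab : a < b) (f : ℝ → ℝ) (hf : ROF.MemBV a b f)
    (lam : ℝ) (hlam : 0 < lam) :
    ∃ u : ℝ → ℝ, ROF.IsMinimizer a b lam f u ∧
      (∀ v : ℝ → ℝ, ROF.IsMinimizer a b lam f v → v =ᵐ[volume.restrict (Ioo a b)] u) ∧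
      ∃ Df Du : SignedMeasure (Ioo a b),
        ROF.HasDistribDeriv a b f Df ∧ ROF.HasDistribDeriv a b u Du ∧
          -ROF.negVar Df ≤ Du ∧ Du ≤ ROF.posVar Df := by
  obtain ⟨D, c, hD⟩ := hf.exists_signedMeasure hab
  set μ := D.toJordanDecomposition.posPart with hμ
  set ν := D.toJordanDecomposition.negPart with hν
  set P := ROF.distribFun μ
  set N := ROF.distribFun ν
  have hP : Monotone P := ROF.monotone_distribFun μ
  have hN : Monotone N := ROF.monotone_distribFun ν
  have hPb : ∀ x, |P x| ≤ μ.real univ := ROF.abs_distribFun_le μ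
  have hNb : ∀ x, |N x| ≤ ν.real univ := ROF.abs_distribFun_le ν
  have hf2 : MemLp f 2 (volume.restrict (Ioo a b)) := by
    refine MemLp.of_bound hf.1.1 (|c| + (μ.real univ + ν.real univ)) ?_
    filter_upwards [hD] with x hx
    rw [hx, Real.norm_eq_abs]
    refine (abs_add_le _ _).trans (add_le_add le_rfl ((abs_sub _ _).trans ?_))
    exact add_le_add (hPb x) (hNb x)
  obtain ⟨p, hp, hvar⟩ := ROF.exists_projection hlam.le hf2.toLp
  set U : ROF.L2I a b := hf2.toLp - p with hU
  -- This representative makes `P - u + c - N = p` hold at every point, so the derivative of `z` can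
  -- be rewritten without excluding a further null set.
  set u : ℝ → ℝ := fun x => c + (P x - N x) - p x with hu
  have huU : u =ᵐ[volume.restrict (Ioo a b)] U := by
    filter_upwards [Lp.coeFn_sub hf2.toLp p, hf2.coeFn_toLp, hD] with x h1 h2 h3
    rw [h1, Pi.sub_apply, h2, h3]
  have hfu : (fun x => f x - u x) =ᵐ[volume.restrict (Ioo a b)] p := by
    filter_upwards [hD] with x h3
    rw [h3, hu]
    ring
  obtain ⟨hmin, huniq⟩ := ROF.isMinimizer_of_dual hlam hf2 hp hvar huU hfu
  set z : ℝ → ℝ := fun x => ∫ t in a..x, p t with hz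
  set G : Set ℝ := {x | x ∈ ROF.mollifyPoints a b u ∧ HasDerivAt z (p x) x}
  have hG : ∀ᵐ x ∂volume.restrict (Ioo a b), x ∈ G := by
    have hd := (ROF.intervalIntegrable_L2I p (left_mem_Icc.2 hab.le)
      (right_mem_Icc.2 hab.le)).ae_hasDerivAt_integral
    filter_upwards [ROF.ae_mem_mollifyPoints hmin.1.1, ae_restrict_of_ae hd] with x h1 h2
    refine ⟨h1, h2 ?_ a left_mem_uIcc⟩
    rw [uIcc_of_le hab.le]
    exact Ioo_subset_Icc_self h1.1
  have hGI : G ⊆ Ioo a b := fun x hx => hx.1.1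
  have hzc : ContinuousOn z (Ioo a b) :=
    (ROF.continuousOn_primitive_L2I p).mono Ioo_subset_Icc_self
  have hzb : ∀ x ∈ Ioo a b, |z x| ≤ lam := fun x hx =>
    ROF.abs_primitive_le_of_mem_closure hp (Ioo_subset_Icc_self hx)
  have hzi : ∀ x ∈ Ioo a b, ∀ y ∈ Ioo a b, IntervalIntegrable p volume x y ∧
      z y - z x = ∫ t in x..y, p t := fun x hx y hy =>
    ⟨ROF.intervalIntegrable_L2I p (Ioo_subset_Icc_self hx) (Ioo_subset_Icc_self hy),
      ROF.primitive_sub_primitive p (Ioo_subset_Icc_self hx) (Ioo_subset_Icc_self hy)⟩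
  have hv : MonotoneOn (fun x => P x - u x + c) G := by
    have hpv : ∀ t, P t - u t + c - N t = p t := fun t => by simp only [hu]; ring
    refine ROF.monotoneOn_of_obstacle (m := -lam) (z := z) (N := N) hG hGI hzc
      (fun x hx => (abs_le.1 (hzb x hx)).1) (fun x hx => ?_) hN (fun x hx y hy _ => ?_)
      (fun x hx y hy hxy h => ?_)
    · rw [hpv]; exact hx.2
    · simp only [hpv]; exact hzi x hx y hy
    · have h1 := ROF.le_of_lt_primitive hp hvar huU hxy hx.1 hy.1 h
      have h2 := hP hxy
      linarith
  have hw : MonotoneOn (fun x => u x + N x - c) G := by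
    have hpv : ∀ t, u t + N t - c - P t = -p t := fun t => by simp only [hu]; ring
    refine ROF.monotoneOn_of_obstacle (m := -lam) (z := fun x => -z x) (N := P) hG hGI hzc.neg
      (fun x hx => neg_le_neg (abs_le.1 (hzb x hx)).2) (fun x hx => ?_) hP
      (fun x hx y hy _ => ?_) (fun x hx y hy hxy h => ?_)
    · rw [hpv]; exact hx.2.neg
    · simp only [hpv]
      obtain ⟨h1, h2⟩ := hzi x hx y hy
      refine ⟨h1.neg, ?_⟩
      rw [intervalIntegral.integral_neg, ← h2]
      ring
    · have h1 := ROF.ge_of_primitive_lt hp hvar huU hxy hx.1 hy.1 fun t ht =>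
        neg_lt_neg_iff.1 (h t ht)
      have h2 := hN hxy
      linarith
  have hsum : ∀ x, |(P x - u x + c) + (u x + N x - c)| ≤ μ.real univ + ν.real univ := fun x => by
    rw [show (P x - u x + c) + (u x + N x - c) = P x + N x by ring]
    exact (abs_add_le _ _).trans (add_le_add (hPb x) (hNb x))
  obtain ⟨hvl, hvu⟩ := ROF.bounded_image_of_monotoneOn_add hv hw fun x _ => hsum x
  obtain ⟨hwl, hwu⟩ := ROF.bounded_image_of_monotoneOn_add hw hv fun x _ => by
    rw [add_comm]; exact hsum x
  obtain ⟨σ, hσ, d, hd⟩ := ROF.exists_measure_of_monotoneOn hG hv hvl hvu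
  obtain ⟨τ, hτ, e, he⟩ := ROF.exists_measure_of_monotoneOn hG hw hwl hwu
  -- The two monotone functions add up to `P + N`. Hence `μ - σ = τ - ν` is one signed measure, the
  -- derivative of `u`: the first form shows the upper bound, the second the lower.
  have hmeas : σ + τ = μ + ν := by
    refine ROF.measure_eq_of_distribFun_ae_eq hab (c := -(d + e)) ?_
    filter_upwards [hd, he] with x h1 h2
    rw [ROF.distribFun_add, ROF.distribFun_add]
    change _ = -(d + e) + (P x + N x)
    linarith
  have hsigned : μ.toSignedMeasure - σ.toSignedMeasure =
      τ.toSignedMeasure - ν.toSignedMeasure := by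
    rw [sub_eq_sub_iff_add_eq_add, ← Measure.toSignedMeasure_add, ← Measure.toSignedMeasure_add,
      Measure.toSignedMeasure_eq_toSignedMeasure_iff, ← hmeas, add_comm]
  have hDf : ROF.HasDistribDeriv a b f D := by
    have := ROF.hasDistribDeriv_of_ae_eq hD
    rwa [← JordanDecomposition.toSignedMeasure, D.toSignedMeasure_toJordanDecomposition] at this
  refine ⟨u, hmin, huniq, D, μ.toSignedMeasure - σ.toSignedMeasure, hDf, ?_, ?_, ?_⟩
  · refine ROF.hasDistribDeriv_of_ae_eq (c := c - d) ?_
    filter_upwards [hd] with x hx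
    change u x = c - d + (P x - ROF.distribFun σ x)
    linarith
  · change -ν.toSignedMeasure ≤ _
    rw [hsigned, VectorMeasure.le_iff]
    intro i hi
    have h0 := VectorMeasure.le_iff.1 (Measure.zero_le_toSignedMeasure τ) i hi
    simp only [neg_apply, sub_apply, zero_apply] at h0 ⊢
    linarith
  · change _ ≤ μ.toSignedMeasure
    rw [VectorMeasure.le_iff]
    intro i hi
    have h0 := VectorMeasure.le_iff.1 (Measure.zero_le_toSignedMeasure σ) i hi
    simp only [sub_apply, zero_apply] at h0 ⊢
    linarith
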